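/- All vector spaces are over $\mathbb{R}$ and all topological spaces are assumed Hausdorff. A locally convex space $E$ is called a Montel space if it is barrelled and every closed bounded subset of $E$ is compact. For a topological space $X$, let $C_p(X)$ be the space of continuous functions $X\to\mathbb{R}$ with the topology of pointwise convergence. A topological space $Y$ is called an Eberlein-Grothendieck space if there is a homeomorphic embedding of $Y$ into $C_p(K)$ for some compact space $K$. Proposition. Let $E$ be a Montel space, and let $w=\sigma(E,E^{*})$ be its weak topology. Then $(E,w)$ is an Eberlein-Grothendieck space if and only if $E$ is metrizable. -/

import Mathlib

/-- The space `C_p(X)` of continuous real-valued functions on `X`, with the topology of pointwise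
convergence, i.e. the subspace topology inherited from the product `X → ℝ`. -/
abbrev CpSpace (X : Type*) [TopologicalSpace X] : Type _ :=
  {f : X → ℝ // Continuous f}

/-- A topological space `Y` is an Eberlein-Grothendieck space if it embeds homeomorphically into
`C_p(K)` for some compact Hausdorff space `K`. Letting `K` range over the universe of `Y` is no
restriction: `K` can always be replaced by its image in `Y → ℝ` under evaluation. -/
def IsEberleinGrothendieck.{u} (Y : Type u) [TopologicalSpace Y] : Prop :=
  ∃ (K : Type u) (_ : TopologicalSpace K) (_ : CompactSpace K) (_ : T2Space K)
    (f : Y → CpSpace K), Topology.IsEmbedding f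

open Set Filter Topology

/-! Suppose `(E, w)` embeds in `C_p(K)`. A functional is bounded by 1 on a weak neighborhood of 0
cut out by finitely many points of `K` and a tolerance. Let `A n` be the functionals for which `n`
points and tolerance `1 / (n + 1)` suffice. These sets increase to the dual, and compactness of the
space of point sequences makes each one pointwise bounded. Barrelledness turns their polars into
neighborhoods, and suitable multiples of these form a countable base at 0, because weakly bounded
sequences are bounded. Conversely, a countable base at 0 writes the dual as a countable union of
pointwise compact polars. Shrinking the `n`-th one towards 0 and adding 0 gives a compact `K`, and
evaluation embeds `(E, w)` in `C_p(K)`. -/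

/-! ### Eberlein-Grothendieck and barrelled implies metrizable. -/

/-- A family in a seminormed space on which every bounded functional is bounded is bounded. -/
theorem bddAbove_range_norm_of_weakly_bounded {F : Type*} [SeminormedAddCommGroup F]
    [NormedSpace ℝ F] {ι : Type*} {y : ι → F}
    (hy : ∀ g : F →ₗ[ℝ] ℝ, (∃ C, ∀ x, |g x| ≤ C * ‖x‖) → BddAbove (range fun i ↦ |g (y i)|)) :
    BddAbove (range fun i ↦ ‖y i‖) := by
  -- The evaluations act on the dual, which is complete even if `F` is not.
  obtain ⟨C, hC⟩ := banach_steinhaus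
    (g := fun i ↦ ContinuousLinearMap.apply ℝ ℝ (y i)) (fun φ ↦ by
      obtain ⟨C, hC⟩ := hy φ.toLinearMap ⟨‖φ‖, φ.le_opNorm⟩
      exact ⟨C, fun i ↦ hC ⟨i, rfl⟩⟩)
  refine ⟨C, ?_⟩
  rintro _ ⟨i, rfl⟩
  obtain ⟨g, hg, hgy⟩ := exists_dual_vector'' ℝ (y i)
  calc ‖y i‖ = g (y i) := hgy.symm
    _ ≤ ‖(ContinuousLinearMap.apply ℝ ℝ (y i)) g‖ := le_abs_self _
    _ ≤ ‖ContinuousLinearMap.apply ℝ ℝ (y i)‖ * ‖g‖ := ContinuousLinearMap.le_opNorm _ _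
    _ ≤ ‖ContinuousLinearMap.apply ℝ ℝ (y i)‖ * 1 := by gcongr
    _ ≤ C := by simpa using hC i

/-- A family on which every continuous functional is bounded is bounded for every continuous
seminorm. -/
theorem Seminorm.bddAbove_range_of_weakly_bounded {E : Type*} [AddCommGroup E] [Module ℝ E]
    [TopologicalSpace E] [IsTopologicalAddGroup E] {p : Seminorm ℝ E} (hp : Continuous p)
    {ι : Type*} {y : ι → E} (hy : ∀ φ : StrongDual ℝ E, BddAbove (range fun i ↦ |φ (y i)|)) :
    BddAbove (range fun i ↦ p (y i)) := by
  let inst := p.toAddGroupSeminorm.toSeminormedAddCommGroup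
  let inst2 : NormedSpace ℝ E := { norm_smul_le := fun a b ↦ (map_smul_eq_mul p a b).le }
  refine @bddAbove_range_norm_of_weakly_bounded E inst inst2 ι y fun g ⟨C, hC⟩ ↦ ?_
  refine hy ⟨g, ?_⟩
  refine continuous_of_continuousAt_zero g ?_
  rw [ContinuousAt, map_zero]
  refine squeeze_zero_norm (a := fun x ↦ C * p x) hC ?_
  exact (continuous_const.mul hp).tendsto' 0 0 (by simp)

/-- In a barrelled space, the polar of a pointwise bounded set of functionals is a neighborhood of
zero. -/
theorem BarrelledSpace.setOf_forall_mul_abs_le_one_mem_nhds {E : Type*} [AddCommGroup E]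
    [Module ℝ E] [TopologicalSpace E] [BarrelledSpace ℝ E] {A : Set (StrongDual ℝ E)}
    (hA : ∀ x, ∃ C : ℝ, ∀ φ ∈ A, |φ x| ≤ C) {c : ℝ} (hc : 0 < c) :
    {x : E | ∀ φ ∈ A, c * |φ x| ≤ 1} ∈ 𝓝 0 := by
  let p : A → Seminorm ℝ E := fun φ ↦ φ.1.toLinearMap.toSeminorm
  have hb : BddAbove (range p) := by
    rw [Seminorm.bddAbove_range_iff]
    intro x
    obtain ⟨C, hC⟩ := hA x
    refine ⟨C, ?_⟩
    rintro _ ⟨φ, rfl⟩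
    exact hC φ.1 φ.2
  have hcont : Continuous fun x ↦ (⨆ φ, p φ) x := by
    simpa only [← Seminorm.coe_iSup_eq hb] using
      Seminorm.continuous_iSup p (fun φ ↦ φ.1.continuous.norm) hb
  have hlt : ∀ᶠ x in 𝓝 (0 : E), (⨆ φ, p φ) x < 1 / c :=
    (hcont.tendsto 0).eventually_lt_const (by rw [map_zero]; positivity)
  filter_upwards [hlt] with x hx φ hφ
  have hle : p ⟨φ, hφ⟩ x ≤ (⨆ φ, p φ) x := le_ciSup hb ⟨φ, hφ⟩ x
  have h2 : |φ x| < 1 / c := lt_of_le_of_lt hle hx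
  rw [lt_div_iff₀ hc] at h2
  linarith

/-- A Hausdorff barrelled space is metrizable if its dual is a countable increasing union of
pointwise bounded sets. -/
theorem BarrelledSpace.metrizableSpace_of_dual_eq_iUnion {E : Type*} [AddCommGroup E]
    [Module ℝ E] [TopologicalSpace E] [IsTopologicalAddGroup E] [ContinuousSMul ℝ E]
    [LocallyConvexSpace ℝ E] [T2Space E] [BarrelledSpace ℝ E] {A : ℕ → Set (StrongDual ℝ E)}
    (hmono : Monotone A) (hcover : ∀ φ, ∃ n, φ ∈ A n)
    (hA : ∀ n x, ∃ C : ℝ, ∀ φ ∈ A n, |φ x| ≤ C) :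
    TopologicalSpace.MetrizableSpace E := by
  have hbasis : (𝓝 (0 : E)).HasBasis (fun _ : ℕ ↦ True)
      -- One factor `n + 1` is spent on rescaling `x n` to `(n + 1) • x n`; the other makes the
      -- rescaled sequence weakly null.
      fun n ↦ {x : E | ∀ φ ∈ A n, ((n : ℝ) + 1) ^ 2 * |φ x| ≤ 1} := by
    refine ⟨fun t ↦ ⟨fun ht ↦ ?_, fun ⟨n, _, hn⟩ ↦ mem_of_superset
      (setOf_forall_mul_abs_le_one_mem_nhds (hA n) (by positivity)) hn⟩⟩
    by_contra! hcon
    have hex : ∀ n : ℕ, ∃ x, (∀ φ ∈ A n, ((n : ℝ) + 1) ^ 2 * |φ x| ≤ 1) ∧ x ∉ t :=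
      fun n ↦ not_subset.1 (hcon n trivial)
    choose x hx hxt using hex
    obtain ⟨U, ⟨hU, hUo, hUc⟩, hUt⟩ := (nhds_hasBasis_absConvex_open ℝ E).mem_iff.1 ht
    let s : AbsConvexOpenSets ℝ E := ⟨U, hU, hUo, hUc⟩
    let p := gaugeSeminormFamily ℝ E s
    have hp : Continuous p := (with_gaugeSeminormFamily (𝕜 := ℝ) (E := E)).continuous_seminorm s
    have hpx : ∀ n, 1 ≤ p (x n) := fun n ↦ by
      by_contra! hlt
      refine hxt n (hUt ?_)
      have : x n ∈ p.ball 0 1 := by rwa [Seminorm.mem_ball_zero]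
      rwa [gaugeSeminormFamily_ball] at this
    obtain ⟨C, hC⟩ := Seminorm.bddAbove_range_of_weakly_bounded hp
      (y := fun n : ℕ ↦ ((n : ℝ) + 1) • x n) (fun φ ↦ by
        obtain ⟨N, hN⟩ := hcover φ
        refine (squeeze_zero' (.of_forall fun _ ↦ abs_nonneg _) ?_
          (tendsto_one_div_add_atTop_nhds_zero_nat (𝕜 := ℝ))).bddAbove_range
        filter_upwards [eventually_ge_atTop N] with n hn
        have h1 := hx n φ (hmono hn hN)
        rw [map_smul, smul_eq_mul, abs_mul, abs_of_pos (by positivity), le_div_iff₀ (by positivity)]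
        linarith)
    obtain ⟨n, hn⟩ := exists_nat_gt C
    have h1 : p (((n : ℝ) + 1) • x n) ≤ C := hC ⟨n, rfl⟩
    rw [map_smul_eq_mul, Real.norm_of_nonneg (by positivity)] at h1
    nlinarith [hpx n]
  have hcg : (𝓝 (0 : E)).IsCountablyGenerated := hbasis.isCountablyGenerated
  let := IsTopologicalAddGroup.rightUniformSpace E
  have : IsUniformAddGroup E := isUniformAddGroup_of_addCommGroup
  have : (uniformity E).IsCountablyGenerated := IsUniformAddGroup.uniformity_countably_generated
  exact UniformSpace.metrizableSpace

/-- A barrelled space with Eberlein-Grothendieck weak topology is metrizable. -/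
theorem IsEberleinGrothendieck.metrizableSpace_of_barrelledSpace {E : Type*} [AddCommGroup E]
    [Module ℝ E] [TopologicalSpace E] [IsTopologicalAddGroup E] [ContinuousSMul ℝ E]
    [LocallyConvexSpace ℝ E] [T2Space E] [BarrelledSpace ℝ E]
    (h : IsEberleinGrothendieck (WeakSpace ℝ E)) : TopologicalSpace.MetrizableSpace E := by
  obtain ⟨K, _, _, _, f, hf⟩ := h
  rcases isEmpty_or_nonempty K with hK | ⟨⟨k₀⟩⟩
  · have : Subsingleton E := ⟨fun a b ↦ hf.injective (a₁ := toWeakSpace ℝ E a)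
      (a₂ := toWeakSpace ℝ E b) (Subtype.ext (funext fun k ↦ isEmptyElim k))⟩
    infer_instance
  -- `f` is only a topological embedding, so its value at 0 is subtracted.
  let g : E → K → ℝ := fun x k ↦ |(f (toWeakSpace ℝ E x)).1 k - (f (toWeakSpace ℝ E 0)).1 k|
  have hgk : ∀ x, Continuous (g x) := fun x ↦ ((f _).2.sub (f _).2).abs
  have hgx : ∀ k, Continuous fun x ↦ g x k := fun k ↦ by
    have h1 : Continuous fun x : E ↦ (f (toWeakSpace ℝ E x)).1 k :=
      (continuous_apply k).comp (continuous_subtype_val.comp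
        (hf.continuous.comp (toWeakSpaceCLM ℝ E).continuous))
    exact (h1.sub continuous_const).abs
  refine BarrelledSpace.metrizableSpace_of_dual_eq_iUnion
    -- Only the first `n` terms of `F` matter; whole sequences keep all witnesses in the one compact
    -- space `ℕ → K`.
    (A := fun n ↦ {φ | ∃ F : ℕ → K, ∀ x, (∀ i < n, g x (F i) < 1 / ((n : ℝ) + 1)) → |φ x| ≤ 1})
    ?_ ?_ ?_
  · rintro m n hmn φ ⟨F, hF⟩
    refine ⟨F, fun x hx ↦ hF x fun i hi ↦ (hx i (hi.trans_le hmn)).trans_le ?_⟩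
    gcongr
  · intro φ
    have hind : IsInducing fun x : WeakSpace ℝ E ↦ (f x).1 := .comp .subtypeVal hf.isInducing
    have hφ : {x : WeakSpace ℝ E | |(topDualPairing ℝ E).flip x φ| < 1} ∈
        𝓝 (toWeakSpace ℝ E 0) :=
      (WeakBilin.eval_continuous (topDualPairing ℝ E).flip φ).abs.continuousAt.eventually_lt_const
        (show |φ 0| < 1 by simp)
    rw [hind.nhds_eq_comap, nhds_pi] at hφ
    obtain ⟨⟨I, ε⟩, ⟨hI, hε⟩, hIφ⟩ :=
      ((hasBasis_pi fun k ↦ Metric.nhds_basis_ball).comap _).mem_iff.1 hφ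
    obtain ⟨δ, hδ, hδε⟩ : ∃ δ > 0, ∀ i ∈ I, δ ≤ ε i := by
      rcases I.eq_empty_or_nonempty with rfl | hne
      · exact ⟨1, one_pos, by simp⟩
      · obtain ⟨i, hi, hmin⟩ := hI.exists_minimalFor ε I hne
        exact ⟨ε i, hε i hi, fun j hj ↦ (le_total (ε i) (ε j)).elim id (hmin hj)⟩
    obtain ⟨N, hN⟩ := exists_nat_one_div_lt hδ
    let l := hI.toFinset.toList
    -- The index must exceed both the number of points and the inverse tolerance; surplus places are
    -- filled with `k₀`.
    refine ⟨max N l.length, fun i ↦ l.getD i k₀, fun x hx ↦ ?_⟩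
    refine le_of_lt (hIφ (a := toWeakSpace ℝ E x) fun k hk ↦ ?_)
    obtain ⟨i, hi, hik⟩ := List.mem_iff_getElem.1
      ((Finset.mem_toList (s := hI.toFinset)).2 (hI.mem_toFinset.2 hk))
    have h1 := hx i (lt_max_of_lt_right hi)
    beta_reduce at h1
    rw [show l.getD i k₀ = k from (List.getD_eq_getElem _ _ hi).trans hik] at h1
    refine h1.trans_le (le_trans ?_ (hN.le.trans (hδε k hk)))
    have : (N : ℝ) ≤ (max N l.length : ℕ) := Nat.cast_le.2 (le_max_left _ _)
    gcongr
  · intro n x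
    by_contra! hcon
    choose φ hφ hφx using fun m : ℕ ↦ hcon m
    choose F hF using hφ
    -- A small multiple `t • x` meets the strict bounds at `G`, hence at `F m` for arbitrarily large
    -- `m`. Then `|φ m x| ≤ 1 / t`, against `|φ m x| > m`.
    obtain ⟨G, hG⟩ := exists_clusterPt_of_compactSpace (map F atTop)
    have h0 : ∀ᶠ t : ℝ in 𝓝[>] 0, ∀ i < n, g (t • x) (G i) < 1 / ((n : ℝ) + 1) := by
      refine nhdsWithin_le_nhds ?_
      refine (finite_lt_nat n).eventually_all.2 fun i _ ↦ ?_
      have hc : Continuous fun t : ℝ ↦ g (t • x) (G i) :=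
        (hgx (G i)).comp (continuous_id.smul continuous_const)
      refine (hc.tendsto 0).eventually_lt_const ?_
      simp only [zero_smul, g, sub_self, abs_zero]
      positivity
    obtain ⟨t, ht, ht0⟩ := (h0.and self_mem_nhdsWithin).exists
    have ht0 : 0 < t := ht0
    have hopen : ∀ᶠ H in 𝓝 G, ∀ i < n, g (t • x) (H i) < 1 / ((n : ℝ) + 1) :=
      (finite_lt_nat n).eventually_all.2 fun i hi ↦
        (((hgk (t • x)).comp (continuous_apply i)).tendsto G).eventually_lt_const (ht i hi)
    have hfreq : ∃ᶠ m in atTop, ∀ i < n, g (t • x) (F m i) < 1 / ((n : ℝ) + 1) :=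
      frequently_map.1 (hG.frequently hopen)
    obtain ⟨N, hN⟩ := exists_nat_gt (1 / t)
    obtain ⟨m, hm, hNm⟩ := (hfreq.and_eventually (eventually_ge_atTop N)).exists
    have h1 := hF m (t • x) hm
    rw [map_smul, smul_eq_mul, abs_mul, abs_of_pos ht0] at h1
    have h2 : 1 / t < |φ m x| := hN.trans_le ((Nat.cast_le.2 hNm).trans (hφx m).le)
    rw [div_lt_iff₀ ht0] at h2
    linarith

/-! ### Metrizable implies Eberlein-Grothendieck. -/

/-- Compact sets converging to a point have compact union with that point. -/
theorem isCompact_insert_iUnion {X : Type*} [TopologicalSpace X] {C : ℕ → Set X}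
    (hC : ∀ n, IsCompact (C n)) {x : X} (hx : ∀ U ∈ 𝓝 x, ∃ N, ∀ n ≥ N, C n ⊆ U) :
    IsCompact (insert x (⋃ n, C n)) := by
  rw [isCompact_iff_ultrafilter_le_nhds']
  intro 𝒰 h𝒰
  by_cases h : ∃ n, C n ∈ 𝒰
  · obtain ⟨n, hn⟩ := h
    obtain ⟨y, hy, hle⟩ := isCompact_iff_ultrafilter_le_nhds'.1 (hC n) 𝒰 hn
    exact ⟨y, mem_insert_of_mem _ (mem_iUnion_of_mem n hy), hle⟩
  · push Not at h
    refine ⟨x, mem_insert _ _, fun U hU ↦ ?_⟩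
    obtain ⟨N, hN⟩ := hx U hU
    have hsub : insert x (⋃ n, C n) ⊆ U ∪ ⋃ n ∈ Iio N, C n := by
      refine insert_subset (.inl (mem_of_mem_nhds hU)) (iUnion_subset fun n y hy ↦ ?_)
      rcases lt_or_ge n N with hn | hn
      · exact .inr (mem_biUnion hn hy)
      · exact .inl (hN n hn hy)
    refine (Ultrafilter.union_mem_iff.1 (mem_of_superset h𝒰 hsub)).resolve_right fun hmem ↦ ?_
    obtain ⟨n, _, hn⟩ := (Ultrafilter.finite_biUnion_mem_iff (finite_Iio N)).1 hmem
    exact h n hn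

theorem isEmbedding_arctan_div {c : ℝ} (hc : 0 < c) : IsEmbedding fun t ↦ Real.arctan t / c := by
  have h1 : IsEmbedding Real.arctan := Real.arctan_strictMono.isEmbedding_of_ordConnected <| by
    rw [Real.range_arctan]; exact ordConnected_Ioo
  exact (Homeomorph.mulRight₀ c⁻¹ (by positivity)).isEmbedding.comp h1

/-- A space whose topology is induced by a countable union of compact sets of functions is
Eberlein-Grothendieck. -/
theorem IsEberleinGrothendieck.of_isEmbedding_iUnion.{u} {Y : Type u} [TopologicalSpace Y]
    {C : ℕ → Set (Y → ℝ)} (hC : ∀ n, IsCompact (C n))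
    (hY : IsEmbedding fun (y : Y) (g : Σ n, C n) ↦ g.2.1 y) : IsEberleinGrothendieck Y := by
  -- `arctan` bounds all values uniformly, so dividing by `n + 1` sends the sets to 0; `e n` is an
  -- embedding, so no topology is lost.
  let e : ℕ → ℝ → ℝ := fun n t ↦ Real.arctan t / ((n : ℝ) + 1)
  have he : ∀ n, IsEmbedding (e n) := fun n ↦ isEmbedding_arctan_div (by positivity)
  let D : ℕ → Set (Y → ℝ) := fun n ↦ (fun g y ↦ e n (g y)) '' C n
  let K : Set (Y → ℝ) := insert 0 (⋃ n, D n)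
  have hK : IsCompact K := by
    refine isCompact_insert_iUnion (fun n ↦ (hC n).image ?_) fun U hU ↦ ?_
    · exact continuous_pi fun y ↦ (he n).continuous.comp (continuous_apply y)
    · rw [nhds_pi] at hU
      obtain ⟨⟨I, ε⟩, ⟨hI, hε⟩, hIU⟩ :=
        (hasBasis_pi fun y ↦ Metric.nhds_basis_ball (x := (0 : Y → ℝ) y)).mem_iff.1 hU
      have hlim : Tendsto (fun n : ℕ ↦ Real.pi * (1 / ((n : ℝ) + 1))) atTop (𝓝 0) := by
        simpa using (tendsto_one_div_add_atTop_nhds_zero_nat (𝕜 := ℝ)).const_mul Real.pi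
      have hev : ∀ᶠ n : ℕ in atTop, ∀ y ∈ I, Real.pi * (1 / ((n : ℝ) + 1)) < ε y :=
        hI.eventually_all.2 fun y hy ↦ hlim.eventually_lt_const (hε y hy)
      obtain ⟨N, hN⟩ := eventually_atTop.1 hev
      refine ⟨N, fun n hn ↦ ?_⟩
      rintro _ ⟨g, -, rfl⟩
      refine hIU fun y hy ↦ ?_
      rw [Metric.mem_ball, Pi.zero_apply, dist_zero_right, Real.norm_eq_abs]
      refine lt_of_le_of_lt ?_ (hN n hn y hy)
      rw [abs_div, abs_of_pos (by positivity : (0 : ℝ) < (n : ℝ) + 1), mul_one_div]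
      gcongr
      have h1 := Real.arctan_lt_pi_div_two (g y)
      have h2 := Real.neg_pi_div_two_lt_arctan (g y)
      rw [abs_le]
      constructor <;> linarith [Real.pi_pos]
  let f : Y → CpSpace K := fun y ↦ ⟨fun k ↦ k.1 y, (continuous_apply y).comp continuous_subtype_val⟩
  let r : CpSpace K → (Σ n, C n) → ℝ := fun c g ↦
    c.1 ⟨fun y ↦ e g.1 (g.2.1 y), .inr (mem_iUnion_of_mem g.1 ⟨g.2.1, g.2.2, rfl⟩)⟩
  have hr : Continuous r := continuous_pi fun g ↦ (continuous_apply _).comp continuous_subtype_val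
  have hg : ∀ g : Σ n, C n, Continuous g.2.1 := fun g ↦ (continuous_apply g).comp hY.continuous
  have hf : Continuous f := by
    refine continuous_induced_rng.2 (continuous_pi fun ⟨k, hk⟩ ↦ ?_)
    change Continuous k
    rcases hk with rfl | hk
    · exact continuous_const
    · obtain ⟨n, g, hgC, rfl⟩ := mem_iUnion.1 hk
      exact (he n).continuous.comp (hg ⟨n, g, hgC⟩)
  have hrf : IsEmbedding (r ∘ f) :=
    (IsEmbedding.piMap fun g : Σ n, C n ↦ he g.1).comp hY
  exact ⟨K, inferInstance, isCompact_iff_compactSpace.1 hK, inferInstance, f, .of_comp hf hr hrf⟩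

/-- The polar of a neighborhood of zero is compact as a set of functions. -/
theorem isCompact_range_coe_inter_polar {E : Type*} [AddCommGroup E] [Module ℝ E]
    [TopologicalSpace E] [ContinuousSMul ℝ E] {U : Set E} (hU : U ∈ 𝓝 0) :
    IsCompact (range ((↑) : (E →ₗ[ℝ] ℝ) → E → ℝ) ∩ {g | ∀ x ∈ U, |g x| ≤ 1}) := by
  have habs : ∀ x, ∃ t : ℝ, 0 < t ∧ t • x ∈ U := fun x ↦ by
    have h1 : ∀ᶠ t : ℝ in 𝓝 0, t • x ∈ U :=
      (continuous_id.smul continuous_const).tendsto' (0 : ℝ) (0 : E) (zero_smul ℝ x) hU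
    have h2 : ∀ᶠ t : ℝ in 𝓝[>] 0, t • x ∈ U := nhdsWithin_le_nhds h1
    obtain ⟨t, ht, ht0⟩ := (h2.and (self_mem_nhdsWithin)).exists
    exact ⟨t, ht0, ht⟩
  choose t ht0 ht using habs
  -- As in Banach-Alaoglu: a closed subset of a product of intervals.
  refine (isCompact_univ_pi fun x ↦ isCompact_Icc (a := -(1 / t x)) (b := 1 / t x)).of_isClosed_subset
    ((LinearMap.isClosed_range_coe E ℝ _).inter ?_) ?_
  · simp only [ofPred_forall]
    exact isClosed_biInter fun x _ ↦ isClosed_le (continuous_apply x).abs continuous_const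
  · rintro _ ⟨⟨g, rfl⟩, hg⟩ x -
    rw [mem_Icc, ← abs_le, le_div_iff₀ (ht0 x)]
    have := hg _ (ht x)
    rwa [map_smul, smul_eq_mul, abs_mul, abs_of_pos (ht0 x), mul_comm] at this

/-- The weak topology of a first countable locally convex space is Eberlein-Grothendieck. -/
theorem IsEberleinGrothendieck.of_firstCountableTopology {E : Type*} [AddCommGroup E]
    [Module ℝ E] [TopologicalSpace E] [IsTopologicalAddGroup E] [ContinuousSMul ℝ E]
    [LocallyConvexSpace ℝ E] [T2Space E] [FirstCountableTopology E] :
    IsEberleinGrothendieck (WeakSpace ℝ E) := by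
  obtain ⟨U, hU⟩ := (𝓝 (0 : E)).exists_antitone_basis
  let C : ℕ → Set (E → ℝ) := fun n ↦
    range ((↑) : (E →ₗ[ℝ] ℝ) → E → ℝ) ∩ {g | ∀ x ∈ U n, |g x| ≤ 1}
  have hCdual : ∀ n, ∀ g ∈ C n, ∃ φ : StrongDual ℝ E, ⇑φ = g := by
    rintro n _ ⟨⟨g, rfl⟩, hg⟩
    refine ⟨g.clmOfExistsBoundedImage ⟨U n, hU.1.mem_of_mem trivial, ?_⟩, rfl⟩
    refine (NormedSpace.isVonNBounded_closedBall ℝ ℝ 1).subset ?_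
    rintro _ ⟨x, hx, rfl⟩
    simpa using hg x hx
  have hdualC : ∀ φ : StrongDual ℝ E, ∃ n, ⇑φ ∈ C n := fun φ ↦ by
    have h1 : {x | |φ x| ≤ 1} ∈ 𝓝 (0 : E) :=
      (φ.continuous.abs.tendsto 0).eventually_le_const (by simp)
    obtain ⟨n, -, hn⟩ := hU.1.mem_iff.1 h1
    exact ⟨n, ⟨φ.toLinearMap, rfl⟩, fun x hx ↦ hn hx⟩
  have hinj : Function.Injective (topDualPairing ℝ E).flip := fun x y hxy ↦ by
    by_contra hne
    obtain ⟨φ, hφ⟩ := geometric_hahn_banach_point_point hne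
    exact hφ.ne (LinearMap.congr_fun hxy φ)
  choose n hn using hdualC
  -- Keeping one index per functional recovers the usual weak embedding.
  let r : ((Σ n, C n) → ℝ) → StrongDual ℝ E → ℝ := fun c φ ↦ c ⟨n φ, φ, hn φ⟩
  refine of_isEmbedding_iUnion (Y := WeakSpace ℝ E) (C := C)
    (fun n ↦ isCompact_range_coe_inter_polar (hU.1.mem_of_mem trivial))
    (.of_comp (g := r) (continuous_pi ?_) (continuous_pi fun φ ↦ continuous_apply _)
      (WeakBilin.isEmbedding hinj))
  rintro ⟨n, g, hg⟩
  obtain ⟨φ, rfl⟩ := hCdual n g hg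
  exact WeakBilin.eval_continuous (topDualPairing ℝ E).flip φ

/-- Let `E` be a Montel space: a real Hausdorff locally convex space which is barrelled and in
which every closed bounded set is compact (`MontelSpace` is only the latter property). Then
`E` with its weak topology is Eberlein-Grothendieck if and only if `E` is metrizable. -/
theorem mainTheorem10 {E : Type*} [AddCommGroup E] [Module ℝ E] [TopologicalSpace E]
    [IsTopologicalAddGroup E] [ContinuousSMul ℝ E] [LocallyConvexSpace ℝ E] [T2Space E]
    [BarrelledSpace ℝ E] [MontelSpace ℝ E] :
    IsEberleinGrothendieck (WeakSpace ℝ E) ↔ TopologicalSpace.MetrizableSpace E := by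
  refine ⟨fun h ↦ h.metrizableSpace_of_barrelledSpace, fun h ↦ ?_⟩
  exact IsEberleinGrothendieck.of_firstCountableTopology
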